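/- For a nonzero $f\in\mathbb Z[x]$ put $\tilde f(x)=x^{\deg f}f(1/x)$ and call $f$ reciprocal if $f=\pm\tilde f$. The non-reciprocal part of a nonzero $f\in\mathbb Z[x]$ is the polynomial obtained from $f$ by removing every irreducible reciprocal factor of $f$ in $\mathbb Z[x]$ with positive leading coefficient (including prime constants), to the multiplicity to which it appears. Theorem. Let $r\ge 1$ be an integer and let $$F(x,y)=\sum_{j=0}^{r} f_j(x)\,y^j\in\mathbb Z[x,y],$$ where the only elements of $\mathbb Z[x]$ dividing all of $f_0,f_1,\dots,f_r$ are $\pm1$, $f_0(0)\ne 0$ and $f_r\ne 0$. Then there is an $N$, depending only on $r,f_0,\dots,f_r$, such that the following holds for every integer $n\ge N$. Consider integers $k,\ell,t$ with $$k\ \ge\ 2\max_{0\le j\le r}\deg f_j,\qquad 0\le t<\frac{k}{r(r+1)},\qquad \ell\ge 1. \qquad (*)$$ Suppose that * for all $k,\ell,t$ satisfying $(*)$ and $n=k\ell+t$, the polynomial $\sum_{j=0}^{r} f_j(x)\,x^{jt}\,y^{j\ell}$ is a power of $x$ (possibly $x^0$) times an irreducible polynomial in $\mathbb Z[x,y]$;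 and * for all $k,\ell,t$ satisfying $(*)$ and $n=k\ell-t$, the polynomial $\sum_{j=0}^{r} f_j(x)\,x^{(r-j)t}\,y^{j\ell}$ is a power of $x$ (possibly $x^0$) times an irreducible polynomial in $\mathbb Z[x,y]$. Then the non-reciprocal part of $F(x,x^n)$ is not reducible in $\mathbb Z[x]$, that is, it is $\pm1$ or irreducible. -/

import Mathlib

open Polynomial
open scoped Polynomial.Bivariate

/-- A nonzero polynomial `f ∈ ℤ[x]` is reciprocal if `f = ± x ^ (deg f) * f (1/x)`.
`Polynomial.reverse f` is `x ^ (deg f) * f (1/x)`; in particular `x` is not reciprocal. -/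
def IsReciprocal (f : ℤ[X]) : Prop :=
  f ≠ 0 ∧ (f = f.reverse ∨ f = -f.reverse)

open Classical in
/-- The product of all irreducible reciprocal factors of `f` in `ℤ[x]` with positive leading
coefficient, each taken to the multiplicity to which it divides `f`.
(`normalizedFactors` lists the irreducible factors with positive leading coefficient.) -/
noncomputable def reciprocalPart (f : ℤ[X]) : ℤ[X] :=
  ((UniqueFactorizationMonoid.normalizedFactors f).filter fun p => IsReciprocal p).prod

open Classical in
/-- The non-reciprocal part of `f ∈ ℤ[x]`: what remains of `f` once each irreducible reciprocal
factor with positive leading coefficient is removed, to the multiplicity to which it appears.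
The sign is that of the leading coefficient of `f`. -/
noncomputable def nonReciprocalPart (f : ℤ[X]) : ℤ[X] :=
  C f.leadingCoeff.sign *
    ((UniqueFactorizationMonoid.normalizedFactors f).filter fun p => ¬ IsReciprocal p).prod

/-- The irreducible factors in `normalizedFactors` have positive leading coefficient. -/
theorem leadingCoeff_pos_of_mem_normalizedFactors {f p : ℤ[X]}
    (hp : p ∈ UniqueFactorizationMonoid.normalizedFactors f) : 0 < p.leadingCoeff := by
  have h1 := UniqueFactorizationMonoid.normalize_normalized_factor p hp
  have h0 : p ≠ 0 := (UniqueFactorizationMonoid.irreducible_of_normalized_factor p hp).ne_zero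
  have h2 : p.leadingCoeff ≠ 0 := leadingCoeff_ne_zero.mpr h0
  have h3 : normalize p.leadingCoeff = p.leadingCoeff := by
    conv_rhs => rw [← h1]
    rw [leadingCoeff_normalize]
  have h4 : (0 : ℤ) ≤ p.leadingCoeff := Int.nonneg_of_normalize_eq_self h3
  omega

/-- Multiplying the non-reciprocal part by the removed factors gives back `f`. -/
theorem nonReciprocalPart_mul_reciprocalPart (f : ℤ[X]) :
    nonReciprocalPart f * reciprocalPart f = f := by
  classical
  by_cases hf : f = 0
  · simp [hf, nonReciprocalPart]
  have h1 : nonReciprocalPart f * reciprocalPart f =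
      C f.leadingCoeff.sign * (UniqueFactorizationMonoid.normalizedFactors f).prod := by
    unfold nonReciprocalPart reciprocalPart
    rw [mul_assoc, ← Multiset.prod_add, add_comm, Multiset.filter_add_not]
  rw [h1]
  have h2 := UniqueFactorizationMonoid.prod_normalizedFactors_eq hf
  rw [h2, normalize_apply, coe_normUnit]
  have h3 : f.leadingCoeff ≠ 0 := leadingCoeff_ne_zero.mpr hf
  rcases lt_or_gt_of_ne h3 with h | h
  · rw [Int.normUnit_eq, if_neg (not_le_of_gt h), Int.sign_eq_neg_one_of_neg h]; simp
  · rw [Int.normUnit_eq, if_pos h.le, Int.sign_eq_one_of_pos h]; simp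

/-- `F(x, y) = f₀(x) + f₁(x) y + ⋯ + f_r(x) y ^ r` as an element of `ℤ[x][y]`. -/
noncomputable def bivariatePoly (r : ℕ) (f : ℕ → ℤ[X]) : ℤ[X][Y] :=
  ∑ j ∈ Finset.range (r + 1), C (f j) * Y ^ j

/-- `∑ f_j(x) x ^ (j t) y ^ (j ℓ)`. -/
noncomputable def twistUp (r : ℕ) (f : ℕ → ℤ[X]) (t l : ℕ) : ℤ[X][Y] :=
  ∑ j ∈ Finset.range (r + 1), C (f j * X ^ (j * t)) * Y ^ (j * l)

/-- `∑ f_j(x) x ^ ((r - j) t) y ^ (j ℓ)`. -/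
noncomputable def twistDown (r : ℕ) (f : ℕ → ℤ[X]) (t l : ℕ) : ℤ[X][Y] :=
  ∑ j ∈ Finset.range (r + 1), C (f j * X ^ ((r - j) * t)) * Y ^ (j * l)

/-- `G` is a power of `x` (possibly `x ^ 0`) times an irreducible polynomial in `ℤ[x, y]`.
In `ℤ[X][Y]` the variable `x` is `C X`. -/
def IsXPowMulIrreducible (G : ℤ[X][Y]) : Prop :=
  ∃ (m : ℕ) (P : ℤ[X][Y]), Irreducible P ∧ G = (C X) ^ m * P

/-- The conditions `k ≥ 2 max deg f_j` and `0 ≤ t < k / (r (r + 1))`, together with `ℓ ≥ 1`. -/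
def AdmissibleTriple (r : ℕ) (f : ℕ → ℤ[X]) (k l t : ℕ) : Prop :=
  2 * (Finset.range (r + 1)).sup (fun j => (f j).natDegree) ≤ k ∧
    (t : ℚ) < (k : ℚ) / ((r : ℚ) * ((r : ℚ) + 1)) ∧ 1 ≤ l

/-!
Suppose the non-reciprocal part of `F(x) = F(x, x ^ n)` is reducible. Then `F = u v` with neither
`u` nor `v` reciprocal (`exists_mul_eq_of_reducible_nonReciprocalPart`). Write `p*` for the reverse
of `p` and put `W = u v*`, so that `W W* = F F*`. The middle coefficient of this identity says that
`W` and `F` have the same sum of squares of coefficients, so the number of terms of `W` is bounded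
independently of `n` (`card_support_le_of_mul_reverse_eq`).

By simultaneous Diophantine approximation there is therefore a modulus `k`, a bounded fraction of
`n`, such that `n = k l + t` with `t` bounded and every exponent of `W` is close to a multiple of
`k` (`exists_modulus`). Up to powers of `x`, the polynomials `W`, `W*`, `F`, `F*` are then
specializations at `y = x ^ k` of polynomials in `ℤ[x, y]` whose degree in `x` is small compared
with `k`, the lift of `F` being `∑ f_j(x) x ^ (j t) y ^ (j l)`. The specialization is injective on
such polynomials (`XDegreeLE.eq_of_eval_eq`), so `W W* = F F*` lifts to `ℤ[x, y]`. The lift of `F`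
is irreducible by hypothesis, hence prime, and it divides the lift of `W` or that of `W*`.
Specializing, `F` divides `W` or `W*` (`dvd_or_dvd_reverse_of_mul_reverse_eq`). In the first case
`v` divides `v*`, in the second `u` divides `u*`, and a polynomial with nonzero constant term that
divides its reverse is reciprocal (`isReciprocal_of_dvd_reverse`), a contradiction.
-/

/-! ### Reciprocal polynomials -/

theorem reverse_reverse_of_coeff_zero_ne {p : ℤ[X]} (hp : p.coeff 0 ≠ 0) :
    p.reverse.reverse = p := by
  have h : p.natTrailingDegree = 0 := natTrailingDegree_eq_zero.mpr (Or.inr hp)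
  have hm : p.mirror = p.reverse := by simp [mirror, h]
  have h2 : p.reverse.natTrailingDegree = 0 := by rw [← hm, mirror_natTrailingDegree, h]
  have hm2 : p.reverse.mirror = p.reverse.reverse := by simp [mirror, h2]
  rw [← hm2, ← hm, mirror_mirror]

/-- The quotient is a constant `a`, as the degrees agree, and reversing twice gives `a * a = 1`. -/
theorem isReciprocal_of_dvd_reverse {p : ℤ[X]} (hp : p.coeff 0 ≠ 0) (h : p ∣ p.reverse) :
    IsReciprocal p := by
  have hp0 : p ≠ 0 := by rintro rfl; simp at hp
  obtain ⟨s, hs⟩ := h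
  have hs0 : s ≠ 0 := by
    rintro rfl
    rw [mul_zero, reverse_eq_zero] at hs
    exact hp0 hs
  have hd : p.reverse.natDegree ≤ p.natDegree := reverse_natDegree_le p
  rw [hs, natDegree_mul hp0 hs0] at hd
  obtain ⟨a, rfl⟩ : ∃ a, s = C a := ⟨_, eq_C_of_natDegree_eq_zero (by omega)⟩
  have h2 := reverse_reverse_of_coeff_zero_ne hp
  rw [hs, reverse_mul_of_domain, reverse_C, hs, mul_assoc, ← C_mul] at h2
  have h3 : (C (a * a) : ℤ[X]) = C 1 := by
    rw [C_1]; exact mul_left_cancel₀ hp0 (by rw [h2, mul_one])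
  have h4 : a * a = 1 := C_injective h3
  refine ⟨hp0, ?_⟩
  rcases mul_self_eq_one_iff.mp h4 with rfl | rfl
  · left; rw [hs]; simp
  · right; rw [hs]; simp

theorem IsReciprocal.dvd_reverse {p : ℤ[X]} (h : IsReciprocal p) : p ∣ p.reverse := by
  rcases h.2 with h | h
  · exact dvd_of_eq h
  · exact (dvd_neg (α := ℤ[X])).mp (dvd_of_eq h)

theorem IsReciprocal.reverse_dvd {p : ℤ[X]} (h : IsReciprocal p) : p.reverse ∣ p := by
  rcases h.2 with h | h
  · exact dvd_of_eq h.symm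
  · exact (neg_dvd (α := ℤ[X])).mp (dvd_of_eq h.symm)

theorem IsReciprocal.of_mul_right {p q : ℤ[X]} (hp : p.coeff 0 ≠ 0)
    (hpq : IsReciprocal (p * q)) (hq : IsReciprocal q) : IsReciprocal p := by
  refine isReciprocal_of_dvd_reverse hp ?_
  have h1 : p * q ∣ p.reverse * q := by
    have := hpq.dvd_reverse
    rw [reverse_mul_of_domain] at this
    exact this.trans (mul_dvd_mul_left _ hq.reverse_dvd)
  exact (mul_dvd_mul_iff_right hq.1).mp h1

theorem IsReciprocal.of_mul_self {p : ℤ[X]} (hp : p.coeff 0 ≠ 0)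
    (h : IsReciprocal (p * p)) : IsReciprocal p := by
  refine isReciprocal_of_dvd_reverse hp ?_
  have h1 := h.dvd_reverse
  rw [reverse_mul_of_domain, ← sq, ← sq] at h1
  exact (UniqueFactorizationMonoid.pow_dvd_pow_iff_dvd two_ne_zero).mp h1

/-- A polynomial with two non-reciprocal irreducible factors (possibly equal) is a product of two
non-reciprocal polynomials. -/
theorem exists_mul_eq_not_isReciprocal {p q s : ℤ[X]} (h0 : (p * (q * s)).coeff 0 ≠ 0)
    (hpi : Prime p) (hp : ¬ IsReciprocal p) (hq : ¬ IsReciprocal q) :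
    ∃ u v : ℤ[X], p * (q * s) = u * v ∧ ¬ IsReciprocal u ∧ ¬ IsReciprocal v := by
  have hp0 : p.coeff 0 ≠ 0 := by rw [mul_coeff_zero] at h0; exact left_ne_zero_of_mul h0
  have hqs : (q * s).coeff 0 ≠ 0 := by rw [mul_coeff_zero] at h0; exact right_ne_zero_of_mul h0
  have hq0 : q.coeff 0 ≠ 0 := by rw [mul_coeff_zero] at hqs; exact left_ne_zero_of_mul hqs
  by_cases hQ : IsReciprocal (q * s)
  swap
  · exact ⟨p, q * s, rfl, hp, hQ⟩
  have hs : ¬ IsReciprocal s := fun hs => hq (hQ.of_mul_right hq0 hs)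
  by_cases hpq : IsReciprocal (p * q)
  swap
  · exact ⟨p * q, s, by ring, hpq, hs⟩
  -- `p` divides the reverse of `q`, hence the reciprocal polynomial `q * s`
  have h1 : p ∣ p.reverse * q.reverse := by
    rw [← reverse_mul_of_domain]
    exact (dvd_mul_right p q).trans hpq.dvd_reverse
  have h2 : p ∣ q.reverse :=
    (hpi.dvd_or_dvd h1).resolve_left fun h => hp (isReciprocal_of_dvd_reverse hp0 h)
  have h3 : p ∣ q * s := by
    refine (h2.trans ?_).trans hQ.reverse_dvd
    rw [reverse_mul_of_domain]
    exact dvd_mul_right _ _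
  obtain ⟨w, hw⟩ := h3
  refine ⟨p * p, w, by rw [hw]; ring, fun h => hp (h.of_mul_self hp0), fun h => hp ?_⟩
  rw [hw] at hQ
  exact hQ.of_mul_right hp0 h

theorem exists_mul_eq_of_reducible_nonReciprocalPart {F : ℤ[X]} (h0 : F.coeff 0 ≠ 0)
    (hu : ¬ IsUnit (nonReciprocalPart F)) (hi : ¬ Irreducible (nonReciprocalPart F)) :
    ∃ u v : ℤ[X], F = u * v ∧ ¬ IsReciprocal u ∧ ¬ IsReciprocal v := by
  classical
  have hF : F ≠ 0 := by rintro rfl; simp at h0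
  have hmul := nonReciprocalPart_mul_reciprocalPart F
  have hsign : IsUnit (C F.leadingCoeff.sign : ℤ[X]) := by
    rw [isUnit_C, Int.isUnit_iff]
    rcases lt_or_gt_of_ne (leadingCoeff_ne_zero.mpr hF) with h | h
    · right; exact Int.sign_eq_neg_one_of_neg h
    · left; exact Int.sign_eq_one_of_pos h
  set m := (UniqueFactorizationMonoid.normalizedFactors F).filter fun p => ¬ IsReciprocal p
    with hm
  have hN : nonReciprocalPart F = C F.leadingCoeff.sign * m.prod := by
    rw [nonReciprocalPart, hm]
  have hmem : ∀ p ∈ m, Prime p ∧ ¬ IsReciprocal p := fun p hp =>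
    ⟨UniqueFactorizationMonoid.prime_of_normalized_factor p (Multiset.mem_filter.mp hp).1,
      (Multiset.mem_filter.mp hp).2⟩
  clear_value m
  clear hm
  rw [hN] at hu hi hmul
  induction m using Multiset.induction_on with
  | empty => exact absurd (by rwa [Multiset.prod_zero, mul_one]) hu
  | cons p m _ =>
    induction m using Multiset.induction_on with
    | empty =>
      refine absurd ?_ hi
      rw [Multiset.cons_zero, Multiset.prod_singleton, irreducible_isUnit_mul hsign]
      exact (hmem p (by simp)).1.irreducible
    | cons q m _ =>
      obtain ⟨hp, hp'⟩ := hmem p (by simp)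
      obtain ⟨-, hq'⟩ := hmem q (by simp)
      have hF' : F = p * (q * (C F.leadingCoeff.sign * m.prod * reciprocalPart F)) := by
        conv_lhs => rw [← hmul]
        rw [Multiset.prod_cons, Multiset.prod_cons]
        ring
      rw [hF'] at h0
      rw [hF']
      exact exists_mul_eq_not_isReciprocal h0 hp hp' hq'

/-! ### Bounding the number of terms -/

/-- The sum of the absolute values of the coefficients. -/
noncomputable def coeffAbsSum (p : ℤ[X]) : ℤ := p.sum fun _ a => |a|

theorem coeffAbsSum_eq_sum {p : ℤ[X]} {s : Finset ℕ} (hs : p.support ⊆ s) :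
    coeffAbsSum p = ∑ i ∈ s, |p.coeff i| :=
  sum_eq_of_subset _ (by simp) hs

theorem coeffAbsSum_add_le (p q : ℤ[X]) :
    coeffAbsSum (p + q) ≤ coeffAbsSum p + coeffAbsSum q := by
  classical
  rw [coeffAbsSum_eq_sum (support_add (p := p) (q := q)),
    coeffAbsSum_eq_sum (p := p) (s := p.support ∪ q.support) Finset.subset_union_left,
    coeffAbsSum_eq_sum (p := q) (s := p.support ∪ q.support) Finset.subset_union_right,
    ← Finset.sum_add_distrib]
  exact Finset.sum_le_sum fun i _ => by rw [coeff_add]; exact abs_add_le _ _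

theorem coeffAbsSum_sum_le {ι : Type*} (s : Finset ι) (g : ι → ℤ[X]) :
    coeffAbsSum (∑ i ∈ s, g i) ≤ ∑ i ∈ s, coeffAbsSum (g i) :=
  Finset.le_sum_of_subadditive _ (by simp [coeffAbsSum]) coeffAbsSum_add_le _ _

theorem coeffAbsSum_mul_X_pow_le (p : ℤ[X]) (m : ℕ) :
    coeffAbsSum (p * X ^ m) ≤ coeffAbsSum p := by
  have h : p * X ^ m = ∑ i ∈ p.support, monomial (i + m) (p.coeff i) := by
    conv_lhs => rw [p.as_sum_support]
    rw [Finset.sum_mul]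
    simp_rw [monomial_mul_X_pow]
  rw [h, coeffAbsSum_eq_sum (p := p) subset_rfl]
  refine (coeffAbsSum_sum_le _ _).trans (Finset.sum_le_sum fun i _ => ?_)
  rw [coeffAbsSum, sum_monomial_index _ _ (by simp)]

theorem sum_sq_coeff_le (p : ℤ[X]) : (p.sum fun _ a => a ^ 2) ≤ coeffAbsSum p ^ 2 := by
  have h := Finset.sum_sq_le_sq_sum_of_nonneg (s := p.support) (f := fun i => |p.coeff i|)
    fun i _ => abs_nonneg _
  simpa [coeffAbsSum, Polynomial.sum_def] using h

theorem card_support_le_sum_sq_coeff (p : ℤ[X]) :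
    (p.support.card : ℤ) ≤ p.sum fun _ a => a ^ 2 := by
  rw [Polynomial.sum_def, Finset.card_eq_sum_ones, Nat.cast_sum]
  refine Finset.sum_le_sum fun i hi => ?_
  have h1 : 0 < p.coeff i ^ 2 := by have := mem_support_iff.mp hi; positivity
  push_cast
  omega

theorem coeff_mul_reverse_natDegree {p : ℤ[X]} (h0 : p.coeff 0 ≠ 0) :
    (p * p.reverse).coeff p.natDegree = p.sum fun _ a => a ^ 2 := by
  have ht : p.natTrailingDegree = 0 := natTrailingDegree_eq_zero.mpr (Or.inr h0)
  have h := p.coeff_mul_mirror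
  rwa [ht, add_zero, mirror, ht, pow_zero, mul_one] at h

/-- If `W * W.reverse = F * F.reverse`, comparing middle coefficients shows that the number of
terms of `W` is controlled by the coefficients of `F`. -/
theorem card_support_le_of_mul_reverse_eq {W F : ℤ[X]} (hW : W.coeff 0 ≠ 0) (hF : F.coeff 0 ≠ 0)
    (hd : W.natDegree = F.natDegree) (h : W * W.reverse = F * F.reverse) :
    (W.support.card : ℤ) ≤ coeffAbsSum F ^ 2 := by
  refine (card_support_le_sum_sq_coeff W).trans (le_trans (le_of_eq ?_) (sum_sq_coeff_le F))
  rw [← coeff_mul_reverse_natDegree hW, ← coeff_mul_reverse_natDegree hF, h, hd]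

/-! ### Simultaneous approximation -/

/-- Dirichlet's theorem on the simultaneous approximation of the fractions `e / n`. -/
theorem exists_simultaneous_approx (S : Finset ℕ) {B M n : ℕ} (hM : 0 < M) (hn : 0 < n)
    (hS : S.card ≤ B) :
    ∃ q : ℕ, 1 ≤ q ∧ q ≤ M ^ B ∧ ∀ e ∈ S, ∃ p : ℕ, |(q : ℤ) * e - p * n| * M < n := by
  classical
  -- `g q e` is the integer part of `M` times the fractional part of `q * e / n`
  let g : ℕ → (S → ℕ) := fun q e => M * (q * e % n) / n
  obtain ⟨a, ha, b, hb, hab, hg⟩ :=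
    Finset.exists_ne_map_eq_of_card_lt_of_maps_to (s := Finset.range (M ^ B + 1))
      (t := Fintype.piFinset fun _ : S => Finset.range M) (f := g)
      (by
        rw [Fintype.card_piFinset]
        simp only [Finset.card_range, Finset.prod_const, Finset.card_univ, Fintype.card_coe]
        exact Nat.lt_succ_of_le (Nat.pow_le_pow_right hM hS))
      (by
        intro q _
        simp only [Finset.mem_coe, Fintype.mem_piFinset, Finset.mem_range, g]
        intro e
        rw [Nat.div_lt_iff_lt_mul hn]
        exact Nat.mul_lt_mul_of_pos_left (Nat.mod_lt _ hn) hM)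
  wlog hlt : a < b generalizing a b
  · exact this b hb a ha hab.symm hg.symm (by omega)
  rw [Finset.mem_range] at hb
  refine ⟨b - a, by omega, by omega, fun e he => ⟨b * e / n - a * e / n, ?_⟩⟩
  have hle : a * e / n ≤ b * e / n := Nat.div_le_div_right (Nat.mul_le_mul_right _ hlt.le)
  have hge : M * (a * e % n) / n = M * (b * e % n) / n := congrFun hg ⟨e, he⟩
  have e1 := Nat.div_add_mod (a * e) n
  have e2 := Nat.div_add_mod (b * e) n
  have e3 := Nat.div_add_mod (M * (a * e % n)) n
  have e4 := Nat.div_add_mod (M * (b * e % n)) n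
  have l3 := Nat.mod_lt (M * (a * e % n)) hn
  have l4 := Nat.mod_lt (M * (b * e % n)) hn
  rw [hge] at e3
  push_cast [Nat.cast_sub hlt.le, Nat.cast_sub hle]
  zify at e1 e2 e3 e4 l3 l4
  have hM' : (0 : ℤ) ≤ M := by positivity
  rw [← abs_of_nonneg hM', ← abs_mul, abs_lt]
  have key : (((b : ℤ) - a) * e - ((b : ℤ) * e / n - (a : ℤ) * e / n) * n) * M
      = M * ((b : ℤ) * e % n) - M * ((a : ℤ) * e % n) := by
    linear_combination (M : ℤ) * e1 - M * e2
  have p3 := Int.emod_nonneg ((M : ℤ) * ((a : ℤ) * e % n)) (by omega : (n : ℤ) ≠ 0)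
  have p4 := Int.emod_nonneg ((M : ℤ) * ((b : ℤ) * e % n)) (by omega : (n : ℤ) ≠ 0)
  constructor <;> linarith

/-- A bounded number of exponents, of size `O(n)`, lie close to multiples of a common modulus `k`,
to which `n` is also close: closeness is measured by `c < k / 8`. -/
theorem exists_modulus (R D B : ℕ) :
    ∃ N : ℕ, ∀ n : ℕ, N ≤ n → ∀ S : Finset ℕ, S.card ≤ B → (∀ e ∈ S, e ≤ R * n + D) →
      ∃ k l t c : ℕ, n = k * l + t ∧ 1 ≤ l ∧ R * t + D ≤ c ∧ 8 * c < k ∧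
        ∀ e ∈ S, ∃ p : ℕ, |(e : ℤ) - p * k| ≤ c := by
  set Q := 32 ^ B with hQ
  set A := (R + 2) * Q + D with hA
  -- `k = n / q` for a common denominator `q ≤ Q`; `32` makes the error `k / 16` beat `8 * c < k`
  refine ⟨Q * (16 * A + 1) + D + 1, fun n hn S hS hSn => ?_⟩
  obtain ⟨q, hq1, hqQ, hq⟩ :=
    exists_simultaneous_approx S (M := 32) (n := n) (by norm_num) (by omega) hS
  rw [← hQ] at hqQ
  have hk : 16 * A + 1 ≤ n / q := by
    rw [Nat.le_div_iff_mul_le (by omega)]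
    have := Nat.mul_le_mul_left (16 * A + 1) hqQ
    linarith
  have hdm := Nat.div_add_mod n q
  have ht := Nat.mod_lt n (show q > 0 by omega)
  set k := n / q with hkdef
  set t := n % q with htdef
  clear_value k t
  refine ⟨k, q, t, A + k / 16, by rw [mul_comm]; exact hdm.symm, hq1, ?_, by omega, ?_⟩
  · have h1 : R * t ≤ R * Q := Nat.mul_le_mul_left _ (by omega)
    have h2 : A = R * Q + 2 * Q + D := by rw [hA]; ring
    omega
  intro e he
  obtain ⟨p, hp⟩ := hq e he
  refine ⟨p, ?_⟩
  have hen := hSn e he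
  set δ := (q : ℤ) * e - p * n with hδ
  push_cast at hp
  have hnD : (D : ℤ) ≤ n := by omega
  have hn0 : (0 : ℤ) < n := by omega
  have hq0 : (1 : ℤ) ≤ q := by omega
  zify at hen hdm ht hqQ
  have hδ1 := neg_abs_le δ
  have hδ2 := le_abs_self δ
  have hpq : (p : ℤ) ≤ q * (R + 2) := by
    have h1 : (p : ℤ) * n ≤ (q * (R + 2)) * n := by
      have h2 : (q : ℤ) * e ≤ q * ((R + 1) * n) := by
        gcongr
        linarith
      have h3 : (1 : ℤ) * n ≤ q * n := by gcongr
      have h4 := abs_nonneg δ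
      nlinarith
    exact le_of_mul_le_mul_right h1 hn0
  have hpt : (p : ℤ) * t ≤ q * ((R + 2) * Q) := by
    calc (p : ℤ) * t ≤ (q * (R + 2)) * Q := by gcongr; linarith
      _ = _ := by ring
  have hpt0 : (0 : ℤ) ≤ p * t := by positivity
  have hx : (q : ℤ) * (e - p * k) = p * t + δ := by
    rw [hδ]; linear_combination -(p : ℤ) * hdm
  have hA' : (A : ℤ) = (R + 2) * Q + D := by rw [hA]; push_cast; ring
  have hup : 32 * ((e : ℤ) - p * k) ≤ 32 * ((R + 2) * Q) + k + 1 := by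
    have : (q : ℤ) * (32 * ((e : ℤ) - p * k)) ≤ q * (32 * ((R + 2) * Q) + k + 1) := by linarith
    exact le_of_mul_le_mul_left this (by omega)
  have hlo : -(k + 1 : ℤ) ≤ 32 * ((e : ℤ) - p * k) := by
    have : (q : ℤ) * (-(k + 1 : ℤ)) ≤ q * (32 * ((e : ℤ) - p * k)) := by linarith
    exact le_of_mul_le_mul_left this (by omega)
  set x := (e : ℤ) - p * k
  set y := ((R : ℤ) + 2) * Q with hy
  have hy0 : 0 ≤ y := by positivity
  rw [abs_le]
  push_cast
  constructor <;> omega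

/-! ### Expansions in powers of `x ^ k` -/

/-- All coefficients of `H ∈ ℤ[x][y]` have degree at most `s` in `x`. -/
def XDegreeLE (s : ℕ) (H : ℤ[X][Y]) : Prop := ∀ j, (H.coeff j).natDegree ≤ s

theorem XDegreeLE.mono {s s' : ℕ} {H : ℤ[X][Y]} (h : XDegreeLE s H) (hs : s ≤ s') :
    XDegreeLE s' H := fun j => (h j).trans hs

theorem XDegreeLE.sub {s : ℕ} {H G : ℤ[X][Y]} (hH : XDegreeLE s H) (hG : XDegreeLE s G) :
    XDegreeLE s (H - G) := fun j => by
  rw [coeff_sub]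
  exact (natDegree_sub_le _ _).trans (max_le (hH j) (hG j))

theorem XDegreeLE.sum {ι : Type*} {s : ℕ} (I : Finset ι) {H : ι → ℤ[X][Y]}
    (hH : ∀ i ∈ I, XDegreeLE s (H i)) : XDegreeLE s (∑ i ∈ I, H i) := fun j => by
  rw [finsetSum_coeff]
  exact natDegree_sum_le_of_forall_le _ _ fun i hi => hH i hi j

theorem XDegreeLE.mul {s s' : ℕ} {H G : ℤ[X][Y]} (hH : XDegreeLE s H) (hG : XDegreeLE s' G) :
    XDegreeLE (s + s') (H * G) := fun j => by
  rw [coeff_mul]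
  exact natDegree_sum_le_of_forall_le _ _ fun i _ => natDegree_mul_le_of_le (hH _) (hG _)

theorem XDegreeLE.C_mul_Y_pow {s : ℕ} {p : ℤ[X]} (hp : p.natDegree ≤ s) (m : ℕ) :
    XDegreeLE s (C p * Y ^ m) := fun j => by
  rw [coeff_C_mul_X_pow]
  split_ifs
  · exact hp
  · simp

/-- The substitution `y = x ^ k` is injective on polynomials of degree less than `k` in `x`. -/
theorem XDegreeLE.eq_zero_of_eval_eq_zero {s k : ℕ} (hs : s < k) {H : ℤ[X][Y]}
    (hH : XDegreeLE s H) (h : H.eval (X ^ k) = 0) : H = 0 := by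
  ext j i
  rw [coeff_zero, coeff_zero]
  by_cases hi : k ≤ i
  · exact coeff_eq_zero_of_natDegree_lt (by have := hH j; omega)
  push Not at hi
  have h1 : (H.eval (X ^ k)).coeff (k * j + i) = (H.coeff j).coeff i := by
    rw [eval_eq_sum, Polynomial.sum_def, finsetSum_coeff]
    rw [Finset.sum_eq_single j]
    · rw [← pow_mul, add_comm, coeff_mul_X_pow]
    · intro j' _ hj'
      rw [← pow_mul, coeff_mul_X_pow']
      split_ifs with hle
      swap
      · rfl
      have hlt : j' < j := by
        have : j' ≤ j := by
          by_contra hc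
          have := Nat.mul_le_mul_left k (show j + 1 ≤ j' by omega)
          rw [mul_add] at this
          omega
        omega
      refine coeff_eq_zero_of_natDegree_lt ?_
      have h2 := Nat.mul_le_mul_left k (show j' + 1 ≤ j by omega)
      rw [mul_add] at h2
      have := hH j'
      omega
    · intro hj
      rw [notMem_support_iff.mp hj, zero_mul, coeff_zero]
  rw [← h1, h, coeff_zero]

theorem XDegreeLE.eq_of_eval_eq {s k : ℕ} (hs : s < k) {H G : ℤ[X][Y]}
    (hH : XDegreeLE s H) (hG : XDegreeLE s G) (h : H.eval (X ^ k) = G.eval (X ^ k)) : H = G :=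
  sub_eq_zero.mp ((hH.sub hG).eq_zero_of_eval_eq_zero hs (by rw [eval_sub, h, sub_self]))

/-- The lift is the expansion of `A` in base `x ^ k`: it replaces `x ^ e` by
`x ^ (e % k) * y ^ (e / k)`. -/
theorem exists_xDegreeLE_eval_eq {s k : ℕ} {A : ℤ[X]} (hA : ∀ e ∈ A.support, e % k ≤ s) :
    ∃ H : ℤ[X][Y], XDegreeLE s H ∧ H.eval (X ^ k) = A := by
  refine ⟨∑ e ∈ A.support, C (C (A.coeff e) * X ^ (e % k)) * Y ^ (e / k),
    XDegreeLE.sum _ fun e he =>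
      XDegreeLE.C_mul_Y_pow ((natDegree_C_mul_X_pow_le _ _).trans (hA e he)) _, ?_⟩
  rw [eval_finsetSum]
  conv_rhs => rw [A.as_sum_support_C_mul_X_pow]
  refine Finset.sum_congr rfl fun e _ => ?_
  rw [eval_mul, eval_C, eval_pow, eval_X, ← pow_mul, mul_assoc, ← pow_add, Nat.mod_add_div]

/-- If every exponent of `A` is within `2 * c` of a multiple of `k`, then `x ^ (2 * c) * A` lifts, as its
exponents have remainder at most `4 * c` modulo `k`. -/
theorem exists_lift {k c : ℕ} (hk : 8 * c < k) {A : ℤ[X]}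
    (hA : ∀ e ∈ A.support, ∃ p : ℤ, -(2 * c) ≤ (e : ℤ) - p * k ∧ (e : ℤ) - p * k ≤ 2 * c) :
    ∃ H : ℤ[X][Y], XDegreeLE (4 * c) H ∧ H.eval (X ^ k) = A * X ^ (2 * c) := by
  refine exists_xDegreeLE_eval_eq fun e' he' => ?_
  rw [mem_support_iff, coeff_mul_X_pow'] at he'
  split_ifs at he' with hle
  swap
  · exact absurd rfl he'
  obtain ⟨p, h1, h2⟩ := hA _ (mem_support_iff.mpr he')
  push_cast [Nat.cast_sub hle] at h1 h2
  have h3 : (e' : ℤ) % k = e' - p * k := by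
    rw [show (e' : ℤ) = (e' - p * k) + p * k by ring, Int.add_mul_emod_self_right,
      Int.emod_eq_of_lt (by linarith) (by omega)]
    ring
  zify
  rw [h3]
  linarith

theorem exists_mem_support_of_mem_support_reverse {p : ℤ[X]} {e : ℕ}
    (he : e ∈ p.reverse.support) : e ≤ p.natDegree ∧ p.natDegree - e ∈ p.support := by
  have hle : e ≤ p.natDegree := (le_natDegree_of_mem_supp e he).trans (reverse_natDegree_le p)
  rw [mem_support_iff, coeff_reverse, revAt_le hle] at he
  exact ⟨hle, mem_support_iff.mpr he⟩

/-! ### Substituting `y = x ^ n` -/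

theorem eval_bivariatePoly (r : ℕ) (f : ℕ → ℤ[X]) (n : ℕ) :
    (bivariatePoly r f).eval (X ^ n) = ∑ j ∈ Finset.range (r + 1), f j * X ^ (n * j) := by
  simp [bivariatePoly, eval_finsetSum, pow_mul]

theorem eval_twistUp (r : ℕ) (f : ℕ → ℤ[X]) (k l t : ℕ) :
    (twistUp r f t l).eval (X ^ k) = (bivariatePoly r f).eval (X ^ (k * l + t)) := by
  rw [eval_bivariatePoly, twistUp, eval_finsetSum]
  refine Finset.sum_congr rfl fun j _ => ?_
  rw [eval_mul, eval_C, eval_pow, eval_X, ← pow_mul, mul_assoc, ← pow_add]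
  congr 2
  ring

theorem coeff_zero_eval_bivariatePoly (r : ℕ) (f : ℕ → ℤ[X]) {n : ℕ} (hn : 0 < n) :
    ((bivariatePoly r f).eval (X ^ n)).coeff 0 = (f 0).eval 0 := by
  rw [eval_bivariatePoly, coeff_zero_eq_eval_zero, eval_finsetSum,
    Finset.sum_eq_single_of_mem 0 (by simp)]
  · simp
  · intro j _ hj
    simp [hn.ne', hj]

theorem coeffAbsSum_eval_bivariatePoly_le (r : ℕ) (f : ℕ → ℤ[X]) (n : ℕ) :
    coeffAbsSum ((bivariatePoly r f).eval (X ^ n)) ≤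
      ∑ j ∈ Finset.range (r + 1), coeffAbsSum (f j) := by
  rw [eval_bivariatePoly]
  exact (coeffAbsSum_sum_le _ _).trans
    (Finset.sum_le_sum fun j _ => coeffAbsSum_mul_X_pow_le _ _)

theorem mem_support_eval_bivariatePoly {r : ℕ} {f : ℕ → ℤ[X]} {n e : ℕ}
    (he : e ∈ ((bivariatePoly r f).eval (X ^ n)).support) :
    ∃ j ≤ r, ∃ i ≤ (Finset.range (r + 1)).sup (fun j => (f j).natDegree), e = n * j + i := by
  rw [mem_support_iff, eval_bivariatePoly, finsetSum_coeff] at he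
  obtain ⟨j, hj, hne⟩ := Finset.exists_ne_zero_of_sum_ne_zero he
  rw [coeff_mul_X_pow'] at hne
  split_ifs at hne with hle
  swap
  · exact absurd rfl hne
  refine ⟨j, by simpa [Nat.lt_succ_iff] using hj, e - n * j, ?_, by omega⟩
  exact (le_natDegree_of_ne_zero hne).trans (Finset.le_sup (f := fun j => (f j).natDegree) hj)

theorem xDegreeLE_twistUp (r : ℕ) (f : ℕ → ℤ[X]) (t l : ℕ) :
    XDegreeLE (r * t + (Finset.range (r + 1)).sup (fun j => (f j).natDegree))
      (twistUp r f t l) := by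
  refine XDegreeLE.sum _ fun j hj => XDegreeLE.C_mul_Y_pow ?_ _
  refine natDegree_mul_le.trans ?_
  rw [natDegree_X_pow, add_comm]
  exact add_le_add (Nat.mul_le_mul_right _ (by simpa [Nat.lt_succ_iff] using hj))
    (Finset.le_sup (f := fun j => (f j).natDegree) hj)

theorem dvd_of_dvd_mul_X_pow {F A : ℤ[X]} (h0 : F.coeff 0 ≠ 0) {m : ℕ} (h : F ∣ A * X ^ m) :
    F ∣ A := by
  have hX : IsRelPrime F (X ^ m) := by
    refine IsRelPrime.pow_right (IsRelPrime.symm ?_)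
    rw [prime_X.irreducible.isRelPrime_iff_not_dvd, X_dvd_iff]
    exact h0
  exact hX.dvd_of_dvd_mul_right h

/-- The lifting argument: `W * W.reverse = F * F.reverse` comes from an identity in `ℤ[x][y]`, in
which the irreducible lift of `F` has to divide the lift of `W` or that of `W.reverse`. -/
theorem dvd_or_dvd_reverse_of_mul_reverse_eq {r : ℕ} {f : ℕ → ℤ[X]} {k l t c : ℕ} {W : ℤ[X]}
    (hk : 8 * c < k) (hl : 1 ≤ l)
    (hc : r * t + (Finset.range (r + 1)).sup (fun j => (f j).natDegree) ≤ c)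
    (h0 : (f 0).eval 0 ≠ 0)
    (hd : W.natDegree = ((bivariatePoly r f).eval (X ^ (k * l + t))).natDegree)
    (hW : W * W.reverse = (bivariatePoly r f).eval (X ^ (k * l + t)) *
      ((bivariatePoly r f).eval (X ^ (k * l + t))).reverse)
    (hS : ∀ e ∈ W.support, ∃ p : ℕ, |(e : ℤ) - p * k| ≤ c)
    (hirr : IsXPowMulIrreducible (twistUp r f t l)) :
    (bivariatePoly r f).eval (X ^ (k * l + t)) ∣ W ∨
      (bivariatePoly r f).eval (X ^ (k * l + t)) ∣ W.reverse := by
  set F := (bivariatePoly r f).eval (X ^ (k * l + t)) with hFdef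
  have hF0 : F.coeff 0 ≠ 0 := by
    rw [hFdef, coeff_zero_eval_bivariatePoly]
    · exact h0
    · have := Nat.mul_le_mul_left k hl
      omega
  have hFne : F ≠ 0 := by intro h; simp [h] at hF0
  have hFS : ∀ e ∈ F.support, ∃ p : ℤ, 0 ≤ (e : ℤ) - p * k ∧ (e : ℤ) - p * k ≤ c := by
    intro e he
    obtain ⟨j, hj, i, hi, rfl⟩ := mem_support_eval_bivariatePoly he
    refine ⟨l * j, ?_⟩
    have h1 : ((((k * l + t) * j + i : ℕ) : ℤ)) - (l * j : ℤ) * k = ((t * j + i : ℕ) : ℤ) := by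
      push_cast; ring
    have h2 : t * j ≤ r * t := by rw [mul_comm r]; exact Nat.mul_le_mul_left _ hj
    rw [h1]
    omega
  -- the degree is an exponent of `F`, so `e ↦ deg F - e` keeps exponents near multiples of `k`
  obtain ⟨pd, hpd⟩ := hFS F.natDegree (natDegree_mem_support_of_nonzero hFne)
  have hWS : ∀ e ∈ W.support, ∃ p : ℤ, -c ≤ (e : ℤ) - p * k ∧ (e : ℤ) - p * k ≤ c := by
    intro e he
    obtain ⟨p, hp⟩ := hS e he
    exact ⟨p, abs_le.mp hp⟩
  have hrev : ∀ {A : ℤ[X]}, A.natDegree = F.natDegree →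
      (∀ e ∈ A.support, ∃ p : ℤ, -c ≤ (e : ℤ) - p * k ∧ (e : ℤ) - p * k ≤ c) →
      ∀ e ∈ A.reverse.support,
        ∃ p : ℤ, -(2 * c) ≤ (e : ℤ) - p * k ∧ (e : ℤ) - p * k ≤ 2 * c := by
    intro A hA hAS e he
    obtain ⟨hle, hmem⟩ := exists_mem_support_of_mem_support_reverse he
    obtain ⟨p, hp⟩ := hAS _ hmem
    rw [Nat.cast_sub hle, hA] at hp
    refine ⟨pd - p, ?_⟩
    rw [sub_mul]
    constructor <;> linarith [hp.1, hp.2, hpd.1, hpd.2]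
  obtain ⟨H₁, hH₁, hH₁e⟩ := exists_lift hk (A := W) fun e he => by
    obtain ⟨p, hp⟩ := hWS e he
    exact ⟨p, by omega, by omega⟩
  obtain ⟨H₂, hH₂, hH₂e⟩ := exists_lift hk (hrev hd hWS)
  obtain ⟨G₂, hG₂, hG₂e⟩ := exists_lift hk (A := F.reverse) <| hrev rfl fun e he => by
    obtain ⟨p, hp⟩ := hFS e he
    exact ⟨p, by omega, hp.2⟩
  have hGe : (twistUp r f t l).eval (X ^ k) = F := eval_twistUp r f k l t
  have hGd := (xDegreeLE_twistUp r f t l).mono hc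
  have hX : XDegreeLE (2 * c) (C (X ^ (2 * c)) : ℤ[X][Y]) := by
    have := XDegreeLE.C_mul_Y_pow (s := 2 * c) (p := X ^ (2 * c)) (natDegree_X_pow_le _) 0
    simpa using this
  have heq : H₁ * H₂ = twistUp r f t l * G₂ * C (X ^ (2 * c)) := by
    refine XDegreeLE.eq_of_eval_eq (s := 8 * c) hk ((hH₁.mul hH₂).mono (by omega))
      (((hGd.mul hG₂).mul hX).mono (by omega)) ?_
    rw [eval_mul, eval_mul, eval_mul, hH₁e, hH₂e, hGe, hG₂e, eval_C]
    linear_combination X ^ (2 * c) * X ^ (2 * c) * hW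
  obtain ⟨m, P, hP, hG⟩ := hirr
  have hFP : F = X ^ m * P.eval (X ^ k) := by
    rw [← hGe, hG, eval_mul, eval_pow, eval_C]
  -- since `F` has a nonzero constant term, the power of `x` is trivial
  have hm : m = 0 := by
    by_contra hm
    apply hF0
    rw [hFP, mul_coeff_zero, coeff_X_pow, if_neg (Ne.symm hm), zero_mul]
  rw [hm, pow_zero, one_mul] at hFP
  have hdvd : P ∣ H₁ * H₂ := by
    rw [heq, hG]
    exact ((dvd_mul_left _ _).mul_right _).mul_right _
  have heval : ∀ {H : ℤ[X][Y]} {A : ℤ[X]}, P ∣ H → H.eval (X ^ k) = A * X ^ (2 * c) → F ∣ A := by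
    intro H A hPH hHA
    refine dvd_of_dvd_mul_X_pow hF0 (m := 2 * c) ?_
    rw [← hHA, hFP]
    exact eval_dvd hPH
  rcases hP.prime.dvd_or_dvd hdvd with h | h
  · exact Or.inl (heval h hH₁e)
  · exact Or.inr (heval h hH₂e)

/-! ### The non-reciprocal part -/

theorem theorem1 (r : ℕ) (hr : 1 ≤ r) (f : ℕ → ℤ[X])
    (hgcd : ∀ d : ℤ[X], (∀ j : ℕ, j ≤ r → d ∣ f j) → IsUnit d)
    (h0 : (f 0).eval 0 ≠ 0) (hfr : f r ≠ 0) :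
    ∃ N : ℕ, ∀ n : ℕ, N ≤ n →
      (∀ k l t : ℕ, AdmissibleTriple r f k l t → (n : ℤ) = (k : ℤ) * (l : ℤ) + (t : ℤ) →
        IsXPowMulIrreducible (twistUp r f t l)) →
      (∀ k l t : ℕ, AdmissibleTriple r f k l t → (n : ℤ) = (k : ℤ) * (l : ℤ) - (t : ℤ) →
        IsXPowMulIrreducible (twistDown r f t l)) →
      IsUnit (nonReciprocalPart ((bivariatePoly r f).eval (X ^ n))) ∨
        Irreducible (nonReciprocalPart ((bivariatePoly r f).eval (X ^ n))) := by
  set D := (Finset.range (r + 1)).sup (fun j => (f j).natDegree) with hD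
  set b : ℤ := ∑ j ∈ Finset.range (r + 1), coeffAbsSum (f j) with hb
  -- the factor `r * (r + 1)` yields both `r * t + D ≤ c` and `t < k / (r * (r + 1))`
  obtain ⟨N, hN⟩ := exists_modulus (r * (r + 1)) D (b ^ 2).toNat
  refine ⟨N + 1, fun n hn hup _ => ?_⟩
  by_contra hcon
  rw [not_or] at hcon
  set F := (bivariatePoly r f).eval (X ^ n) with hF
  have hF0 : F.coeff 0 ≠ 0 := by
    rw [hF, coeff_zero_eval_bivariatePoly r f (by omega)]
    exact h0
  have hFne : F ≠ 0 := by intro h; simp [h] at hF0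
  obtain ⟨u, v, huv, hu, hv⟩ := exists_mul_eq_of_reducible_nonReciprocalPart hF0 hcon.1 hcon.2
  have hF0' := hF0
  rw [huv, mul_coeff_zero] at hF0'
  have hu0 : u.coeff 0 ≠ 0 := left_ne_zero_of_mul hF0'
  have hv0 : v.coeff 0 ≠ 0 := right_ne_zero_of_mul hF0'
  have hune : u ≠ 0 := by rintro rfl; simp at hu0
  have hvne : v ≠ 0 := by rintro rfl; simp at hv0
  have hWrev : (u * v.reverse).reverse = u.reverse * v := by
    rw [reverse_mul_of_domain, reverse_reverse_of_coeff_zero_ne hv0]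
  have hWd : (u * v.reverse).natDegree = F.natDegree := by
    rw [huv, natDegree_mul hune hvne, natDegree_mul hune (by rwa [Ne, reverse_eq_zero]),
      reverse_natDegree, natTrailingDegree_eq_zero.mpr (Or.inr hv0), Nat.sub_zero]
  have hW0 : (u * v.reverse).coeff 0 ≠ 0 := by
    rw [mul_coeff_zero, coeff_zero_reverse]
    exact mul_ne_zero hu0 (leadingCoeff_ne_zero.mpr hvne)
  have hWW : u * v.reverse * (u * v.reverse).reverse = F * F.reverse := by
    rw [hWrev, huv, reverse_mul_of_domain]
    ring
  have hcard : (u * v.reverse).support.card ≤ (b ^ 2).toNat := by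
    have h1 := card_support_le_of_mul_reverse_eq hW0 hF0 hWd hWW
    have h2 : coeffAbsSum F ^ 2 ≤ b ^ 2 :=
      pow_le_pow_left₀ (Finset.sum_nonneg fun _ _ => abs_nonneg _)
        (coeffAbsSum_eval_bivariatePoly_le r f n) 2
    omega
  have hsize : ∀ e ∈ (u * v.reverse).support, e ≤ r * (r + 1) * n + D := by
    intro e he
    have h1 := le_natDegree_of_mem_supp e he
    rw [hWd] at h1
    obtain ⟨j, hj, i, hi, hji⟩ :=
      mem_support_eval_bivariatePoly (natDegree_mem_support_of_nonzero hFne)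
    have h2 : n * j ≤ r * (r + 1) * n := by
      rw [mul_comm n]
      exact Nat.mul_le_mul_right _ (by nlinarith)
    rw [← hF] at hji
    omega
  obtain ⟨k, l, t, c, hnk, hl, hc, hk, hS⟩ := hN n (by omega) _ hcard hsize
  have hadm : AdmissibleTriple r f k l t := by
    refine ⟨by omega, ?_, hl⟩
    have hrpos : (0 : ℚ) < (r : ℚ) * ((r : ℚ) + 1) := by
      have : (0 : ℚ) < r := by exact_mod_cast hr
      positivity
    rw [lt_div_iff₀ hrpos]
    have h1 : t * (r * (r + 1)) < k := by rw [mul_comm]; omega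
    exact_mod_cast h1
  have hirr := hup k l t hadm (by exact_mod_cast hnk)
  have hc' : r * t + D ≤ c := by
    have : r * t ≤ r * (r + 1) * t := Nat.mul_le_mul_right _ (by nlinarith)
    omega
  rw [hnk] at hF
  rw [hF] at hWd hWW huv
  rcases dvd_or_dvd_reverse_of_mul_reverse_eq hk hl hc' h0 hWd hWW hS hirr with h | h
  · rw [huv] at h
    exact hv (isReciprocal_of_dvd_reverse hv0 ((mul_dvd_mul_iff_left hune).mp h))
  · rw [huv, hWrev] at h
    exact hu (isReciprocal_of_dvd_reverse hu0 ((mul_dvd_mul_iff_right hvne).mp h))
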